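/- Let $\mathcal X$ be a measurable space and let $k:\mathcal X\times\mathcal X\to\mathbb R$ be a symmetric, positive (semi)definite, jointly measurable and uniformly bounded kernel (for instance, a bounded continuous kernel on a second countable topological space with its Borel $\sigma$-algebra), with reproducing kernel Hilbert space $(\mathcal H_k,\|\cdot\|_k)$. Let $\rho$ be a probability measure on $\mathcal X\times\mathbb R$ with $\int y^2\,\rho(dx,dy)<\infty$, let $P=\rho(\cdot\times\mathbb R)$ be its first marginal and $f_0(x)=\int y\,\rho(dy\mid x)$ its regression function (the conditional expectation of the response given $x$). Let $K:L^2(P)\to L^2(P)$ be the integral operator $Kw(x)=\int k(x,y)\,w(y)\,P(dy)$ and, for $\lambda>0$, let $f_\lambda=Kw_\lambda\in\mathcal H_k$ with $w_\lambda=(\lambda+K)^{-1}f_0$, so that $f_\lambda=(\lambda+K)^{-1}Kf_0$ in $L^2(P)$. For i.i.d. observations $(X_i,f_i)$, $i=1,\dots,n$, with law $\rho$ let $$\hat f_n=\frac1n\sum_{i=1}^n \hat w_i\,k(\cdot,X_i),\qquad \hat w=\Big(\lambda+\tfrac1n\big(k(X_i,X_j)\big)_{i,j=1}^n\Big)^{-1}(f_1,\dots,f_n)^\top,$$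 be the kernel ridge regression estimator. Then there are constants $C_1,C_2>0$, depending only on $k$ and $\rho$ and in particular not on $\lambda$ and $n$, such that for all $\lambda>0$ and all $n\ge1$ $$\mathbb E\,\|\hat f_n-f_\lambda\|_k^2\le\frac{2C_1}{\lambda^2n}+\frac{C_2}{\lambda^3n}\qquad\text{and}\qquad \mathbb E\,\|\hat f_n-f_\lambda\|_{L^2(P)}^2\le\frac{2C_1}{\lambda^2n}+\frac{C_2}{\lambda^3n},$$ where both expectations are of integrable random variables. -/

import Mathlib

open MeasureTheory ProbabilityTheory
open scoped InnerProductSpace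

noncomputable section

/-- A kernel on `𝒳`: a symmetric, positive (semi)definite function `k : 𝒳 × 𝒳 → ℝ` that is
jointly measurable and uniformly bounded. (A continuous kernel on a second countable space with its
Borel σ-algebra is jointly measurable.) -/
structure BddKernel (𝒳 : Type*) [MeasurableSpace 𝒳] where
  toFun : 𝒳 → 𝒳 → ℝ
  symm : ∀ x y, toFun x y = toFun y x
  posDef : ∀ (s : Finset 𝒳) (c : 𝒳 → ℝ), 0 ≤ ∑ x ∈ s, ∑ y ∈ s, c x * c y * toFun x y
  measurable : Measurable fun p : 𝒳 × 𝒳 => toFun p.1 p.2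
  bounded : ∃ B : ℝ, ∀ x y, |toFun x y| ≤ B

namespace BddKernel

variable {𝒳 : Type*} [MeasurableSpace 𝒳]

instance : CoeFun (BddKernel 𝒳) (fun _ => 𝒳 → 𝒳 → ℝ) := ⟨BddKernel.toFun⟩

/-! ### The reproducing kernel Hilbert space -/

/-- The kernel `k` with its values read as multiplication operators on `ℝ`, which is the form in
which Mathlib's (vector-valued) reproducing kernel Hilbert spaces take a kernel. -/
def opKernel (k : BddKernel 𝒳) : Matrix 𝒳 𝒳 (ℝ →L[ℝ] ℝ) :=
  .of fun x y => k x y • ContinuousLinearMap.id ℝ ℝ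

@[simp] lemma opKernel_apply (k : BddKernel 𝒳) (x y : 𝒳) (v : ℝ) :
    k.opKernel x y v = k x y * v := rfl

lemma posSemidef_opKernel (k : BddKernel 𝒳) : k.opKernel.PosSemidef := by
  have htfae := RKHS.posSemidef_tfae (K := k.opKernel)
  refine (htfae.out 0 2).mpr (And.intro ?_ fun vv => ?_)
  · ext x y
    have hid : star (ContinuousLinearMap.id ℝ ℝ) = ContinuousLinearMap.id ℝ ℝ :=
      star_one (ℝ →L[ℝ] ℝ)
    simp [opKernel, Matrix.conjTranspose_apply, k.symm x y, hid]
  · have h := k.posDef vv.support vv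
    simp only [Finsupp.sum, opKernel_apply, RCLike.re_to_real]
    refine h.trans_eq (Finset.sum_congr rfl fun x _ => Finset.sum_congr rfl fun y _ => ?_)
    simp only [RCLike.inner_apply, conj_trivial, k.symm x y]
    ring

instance (k : BddKernel 𝒳) : Fact k.opKernel.PosSemidef := ⟨k.posSemidef_opKernel⟩

/-- The reproducing kernel Hilbert space `ℋ_k`: the completion of the span of the functions
`k(·, x)` for the inner product with `⟪k(·, x), k(·, y)⟫ = k x y`, as a space of functions
`𝒳 → ℝ`. -/
abbrev Hk (k : BddKernel 𝒳) := RKHS.OfKernel k.opKernel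

/-- The function `k(·, y)` as an element of `ℋ_k`. -/
def kfun (k : BddKernel 𝒳) (y : 𝒳) : k.Hk := RKHS.kerFun k.Hk y (1 : ℝ)

lemma kfun_apply (k : BddKernel 𝒳) (x y : 𝒳) : k.kfun y x = k x y := by
  simp [kfun, RKHS.kerFun_apply]

lemma inner_kfun (k : BddKernel 𝒳) (x : 𝒳) (g : k.Hk) : ⟪k.kfun x, g⟫_ℝ = g x := by
  simp [kfun]

lemma inner_kfun_kfun (k : BddKernel 𝒳) (x y : 𝒳) : ⟪k.kfun x, k.kfun y⟫_ℝ = k x y := by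
  rw [inner_kfun, kfun_apply]

/-- The values of a function in `ℋ_k` are bounded by a multiple of its norm. -/
lemma exists_bound (k : BddKernel 𝒳) : ∃ B : ℝ, 0 ≤ B ∧ ∀ (g : k.Hk) (x : 𝒳), |g x| ≤ B * ‖g‖ := by
  obtain ⟨B, hB⟩ := k.bounded
  refine ⟨√B, Real.sqrt_nonneg _, fun g x => ?_⟩
  rw [← inner_kfun]
  refine (abs_real_inner_le_norm _ _).trans ?_
  gcongr
  rw [norm_eq_sqrt_real_inner, inner_kfun_kfun]
  exact Real.sqrt_le_sqrt ((le_abs_self _).trans (hB x x))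

lemma measurable_coe (k : BddKernel 𝒳) (g : k.Hk) : Measurable g := by
  have hd : g ∈ closure (Submodule.span ℝ {RKHS.kerFun k.Hk x v | (x) (v)} : Set k.Hk) := by
    rw [← Submodule.topologicalClosure_coe, RKHS.kerFun_dense]; trivial
  obtain ⟨u, hu, hlim⟩ := mem_closure_iff_seq_limit.mp hd
  refine measurable_of_tendsto_metrizable (f := fun n => ⇑(u n)) (fun n => ?_)
    (tendsto_pi_nhds.mpr fun x => ((RKHS.continuous_eval x).tendsto g).comp hlim)
  have hun : u n ∈ Submodule.span ℝ {RKHS.kerFun k.Hk x v | (x) (v)} := hu n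
  refine Submodule.span_induction (p := fun (g : k.Hk) _ => Measurable (⇑g)) ?_ ?_ ?_ ?_ hun
  · rintro _ ⟨y, v, rfl⟩
    have : (⇑(RKHS.kerFun k.Hk y v) : 𝒳 → ℝ) = fun x => k x y * v := by
      funext x; simp [RKHS.kerFun_apply]
    rw [this]
    exact (k.measurable.comp measurable_prodMk_right).mul_const v
  · rw [RKHS.coe_zero]; exact measurable_const
  · intro a b _ _ ha hb
    rw [RKHS.coe_add]; exact ha.add hb
  · intro c a _ ha
    rw [RKHS.coe_smul]; exact ha.const_smul c

/-! ### The integral operator -/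

variable (k : BddKernel 𝒳) (P : Measure 𝒳) [IsProbabilityMeasure P]

lemma memLp_coe (g : k.Hk) : MemLp (g : 𝒳 → ℝ) 2 P := by
  obtain ⟨B, -, hB⟩ := k.exists_bound
  exact MemLp.of_bound (k.measurable_coe g).aestronglyMeasurable (B * ‖g‖)
    (.of_forall fun x => hB g x)

/-- The inclusion `ℋ_k → L²(P)`. -/
def toL2 : k.Hk →L[ℝ] Lp ℝ 2 P :=
  LinearMap.mkContinuousOfExistsBound
    { toFun := fun g => (k.memLp_coe P g).toLp g
      map_add' := fun g h => by
        simp only [RKHS.coe_add]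
        exact MemLp.toLp_add (k.memLp_coe P g) (k.memLp_coe P h)
      map_smul' := fun c g => by
        simp only [RKHS.coe_smul]
        exact MemLp.toLp_const_smul c (k.memLp_coe P g) }
    (by
      obtain ⟨B, hB0, hB⟩ := k.exists_bound
      refine ⟨B, fun g => ?_⟩
      have h := Lp.norm_le_of_ae_bound (μ := P) (f := (k.memLp_coe P g).toLp g) (C := B * ‖g‖)
        (by positivity)
        (by
          filter_upwards [(k.memLp_coe P g).coeFn_toLp] with x hx
          rw [hx]; exact hB g x)
      have h1 : measureUnivNNReal P = 1 := by simp [measureUnivNNReal]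
      rw [h1, NNReal.coe_one, Real.one_rpow, one_mul] at h
      exact h)

lemma coeFn_toL2 (g : k.Hk) : k.toL2 P g =ᵐ[P] g := (k.memLp_coe P g).coeFn_toLp

/-- The function `x ↦ ∫ k(x, y) w(y) P(dy)`, defined at every point. -/
def kernelInt (w : 𝒳 → ℝ) (x : 𝒳) : ℝ := ∫ y, k x y * w y ∂P

/-- For `w ∈ L²(P)` the function `∫ k(·, y) w(y) P(dy)`, as an element of `ℋ_k`; it is the
representative of the functional `g ↦ ∫ g w dP`, and its values are given by `toHk_apply`. -/
def toHk : Lp ℝ 2 P →L[ℝ] k.Hk := ContinuousLinearMap.adjoint (k.toL2 P)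

lemma toHk_apply (w : Lp ℝ 2 P) (x : 𝒳) : k.toHk P w x = k.kernelInt P w x := by
  rw [← inner_kfun, toHk, ContinuousLinearMap.adjoint_inner_right, L2.inner_def, kernelInt]
  refine integral_congr_ae ?_
  filter_upwards [k.coeFn_toL2 P (k.kfun x)] with y hy
  rw [hy, kfun_apply, k.symm x y]
  simp [mul_comm]

lemma coe_toHk (w : Lp ℝ 2 P) : ⇑(k.toHk P w) = k.kernelInt P w :=
  funext (k.toHk_apply P w)

lemma memLp_kernelInt (w : Lp ℝ 2 P) : MemLp (k.kernelInt P w) 2 P :=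
  k.coe_toHk P w ▸ k.memLp_coe P (k.toHk P w)

lemma toLp_kernelInt (w : Lp ℝ 2 P) :
    (k.memLp_kernelInt P w).toLp (k.kernelInt P w) = k.toL2 P (k.toHk P w) :=
  MemLp.toLp_congr _ (k.memLp_coe P (k.toHk P w)) (by rw [coe_toHk])

/-- The integral operator `K : L²(P) → L²(P)`, `K w (x) = ∫ k(x, y) w(y) P(dy)`. -/
def integralOp : Lp ℝ 2 P →L[ℝ] Lp ℝ 2 P where
  toFun w := (k.memLp_kernelInt P w).toLp (k.kernelInt P w)
  map_add' w v := by simp only [toLp_kernelInt, map_add]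
  map_smul' c w := by simp only [toLp_kernelInt, map_smul, RingHom.id_apply]
  cont := by simp only [toLp_kernelInt]; fun_prop

lemma integralOp_apply (w : Lp ℝ 2 P) : k.integralOp P w = k.toL2 P (k.toHk P w) :=
  k.toLp_kernelInt P w

/-- The operator `lam + K` on `L²(P)`. -/
def shiftedOp (lam : ℝ) : Lp ℝ 2 P →L[ℝ] Lp ℝ 2 P :=
  lam • ContinuousLinearMap.id ℝ (Lp ℝ 2 P) + k.integralOp P

lemma isUnit_shiftedOp {lam : ℝ} (hlam : 0 < lam) : IsUnit (k.shiftedOp P lam) := by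
  refine ContinuousLinearMap.isUnit_of_forall_le_norm_inner_map _ (c := lam.toNNReal)
    (Real.toNNReal_pos.mpr hlam) fun w => ?_
  have h : ⟪k.shiftedOp P lam w, w⟫_ℝ = lam * ‖w‖ ^ 2 + ‖k.toHk P w‖ ^ 2 := by
    simp only [shiftedOp, FunLike.coe_add, Pi.add_apply, inner_add_left, integralOp_apply,
      FunLike.coe_smul, Pi.smul_apply, ContinuousLinearMap.id_apply,
      real_inner_smul_left, real_inner_self_eq_norm_sq]
    rw [← ContinuousLinearMap.adjoint_inner_right, ← toHk, real_inner_self_eq_norm_sq]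
  rw [h, Real.coe_toNNReal _ hlam.le, Real.norm_eq_abs]
  refine le_trans ?_ (le_abs_self _)
  nlinarith [sq_nonneg ‖k.toHk P w‖]

/-- `(lam + K)⁻¹` on `L²(P)`; see `isUnit_shiftedOp` for the invertibility when `lam > 0`. -/
def resolvent (lam : ℝ) : Lp ℝ 2 P →L[ℝ] Lp ℝ 2 P := Ring.inverse (k.shiftedOp P lam)

end BddKernel

/-! ### The regression function and the regularized solution -/

section Regression

variable {𝒳 : Type*} [MeasurableSpace 𝒳]

/-- The regression function `f₀(x) = E(f | X = x) = ∫ y ρ(dy | x)`, through the disintegration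
`ρ(dx, dy) = ρ(dy | x) P(dx)` with the design measure `P = ρ.fst`. -/
def regressionFun (ρ : Measure (𝒳 × ℝ)) [IsProbabilityMeasure ρ] (x : 𝒳) : ℝ :=
  ∫ y, y ∂(ρ.condKernel x)

lemma memLp_regressionFun (ρ : Measure (𝒳 × ℝ)) [IsProbabilityMeasure ρ]
    (hρ : MemLp (fun z : 𝒳 × ℝ => z.2) 2 ρ) : MemLp (regressionFun ρ) 2 ρ.fst := by
  have hm : StronglyMeasurable (regressionFun ρ) :=
    StronglyMeasurable.integral_kernel (f := fun y : ℝ => y) (by fun_prop)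
  rw [memLp_two_iff_integrable_sq hm.aestronglyMeasurable]
  have hsq : Integrable (fun z : 𝒳 × ℝ => z.2 ^ 2) ρ := hρ.integrable_sq
  have hsq' := hsq
  rw [← ρ.disintegrate ρ.condKernel, Measure.integrable_compProd_iff (by fun_prop)] at hsq'
  obtain ⟨h1, h2⟩ := hsq'
  refine h2.mono' (hm.pow 2).aestronglyMeasurable ?_
  filter_upwards [h1] with x hx
  have hx2 : MemLp (fun y : ℝ => y) 2 (ρ.condKernel x) :=
    (memLp_two_iff_integrable_sq (by fun_prop)).mpr hx
  have hv := variance_nonneg (fun y : ℝ => y) (ρ.condKernel x)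
  rw [variance_eq_sub hx2] at hv
  simp only [Pi.pow_apply, sub_nonneg] at hv
  simpa [regressionFun] using hv

/-- The regularized solution `f_lam = K w_lam ∈ ℋ_k`, where `w_lam = (lam + K)⁻¹ f₀ ∈ L²(P)`;
equivalently `f_lam = (lam + K)⁻¹ K f₀`, see `toL2_regularizedSol`. -/
def regularizedSol (k : BddKernel 𝒳) (ρ : Measure (𝒳 × ℝ)) [IsProbabilityMeasure ρ]
    (hρ : MemLp (fun z : 𝒳 × ℝ => z.2) 2 ρ) (lam : ℝ) : k.Hk :=
  k.toHk ρ.fst (k.resolvent ρ.fst lam ((memLp_regressionFun ρ hρ).toLp (regressionFun ρ)))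

lemma toL2_regularizedSol (k : BddKernel 𝒳) (ρ : Measure (𝒳 × ℝ)) [IsProbabilityMeasure ρ]
    (hρ : MemLp (fun z : 𝒳 × ℝ => z.2) 2 ρ) {lam : ℝ} (hlam : 0 < lam) :
    k.toL2 ρ.fst (regularizedSol k ρ hρ lam) = k.resolvent ρ.fst lam
      (k.integralOp ρ.fst ((memLp_regressionFun ρ hρ).toLp (regressionFun ρ))) := by
  have hc : Commute (k.shiftedOp ρ.fst lam) (k.integralOp ρ.fst) :=
    Commute.add_left (Commute.smul_left (Commute.one_left _) lam) (Commute.refl _)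
  have hc' : Commute (k.resolvent ρ.fst lam) (k.integralOp ρ.fst) := by
    obtain ⟨u, hu⟩ := k.isUnit_shiftedOp ρ.fst hlam
    rw [BddKernel.resolvent, ← hu, Ring.inverse_unit]
    rw [← hu] at hc
    exact hc.units_inv_left
  rw [regularizedSol, ← k.integralOp_apply]
  exact (DFunLike.congr_fun hc'.eq _).symm

/-! ### The kernel ridge regression estimator -/

/-- The weights `ŵ = (lam + (1/n) K)⁻¹ f`, where `K` is the Gram matrix `k(x_i, x_j)`. -/
def krrWeights (k : BddKernel 𝒳) (lam : ℝ) {n : ℕ} (x : Fin n → 𝒳) (f : Fin n → ℝ) : Fin n → ℝ :=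
  (lam • (1 : Matrix (Fin n) (Fin n) ℝ) +
    (1 / (n : ℝ)) • Matrix.of fun i j => k (x i) (x j))⁻¹.mulVec f

/-- The weights solve `lam ŵ_i + (1/n) ∑ j, k(x_i, x_j) ŵ_j = f_i`. -/
lemma krrWeights_spec (k : BddKernel 𝒳) {lam : ℝ} (hlam : 0 < lam) {n : ℕ} (x : Fin n → 𝒳)
    (f : Fin n → ℝ) (i : Fin n) :
    lam * krrWeights k lam x f i + 1 / (n : ℝ) * ∑ j, k (x i) (x j) * krrWeights k lam x f j
      = f i := by
  have hG : (Matrix.of fun i j => k (x i) (x j)).PosSemidef := by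
    have : (Matrix.of fun i j => k (x i) (x j)) = Matrix.gram ℝ (fun i => k.kfun (x i)) := by
      ext i j; simp [Matrix.gram, BddKernel.inner_kfun_kfun]
    rw [this]; exact Matrix.posSemidef_gram ℝ _
  have hA : (lam • (1 : Matrix (Fin n) (Fin n) ℝ) +
      (1 / (n : ℝ)) • Matrix.of fun i j => k (x i) (x j)).PosDef :=
    (Matrix.PosDef.one.smul hlam).add_posSemidef (hG.smul (by positivity))
  have h : (lam • (1 : Matrix (Fin n) (Fin n) ℝ) +
      (1 / (n : ℝ)) • Matrix.of fun i j => k (x i) (x j)).mulVec (krrWeights k lam x f) = f := by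
    rw [krrWeights, Matrix.mulVec_mulVec, Matrix.mul_nonsing_inv _
      ((Matrix.isUnit_iff_isUnit_det _).mp hA.isUnit), Matrix.one_mulVec]
  rw [Matrix.add_mulVec, Matrix.smul_mulVec, Matrix.smul_mulVec, Matrix.one_mulVec] at h
  simpa [Matrix.mulVec, dotProduct] using congrFun h i

/-- The kernel ridge regression estimator `f̂_n = (1/n) ∑ i, ŵ_i k(·, x_i)`, an element of `ℋ_k`,
for the data `(x_i, f_i)`, `i < n`. -/
def krrEstimator (k : BddKernel 𝒳) (lam : ℝ) {n : ℕ} (x : Fin n → 𝒳) (f : Fin n → ℝ) : k.Hk :=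
  (1 / (n : ℝ)) • ∑ i, krrWeights k lam x f i • k.kfun (x i)

end Regression

end

/-! ### Norm bounds and pairings for `ℋ_k` and `L²(P)`. -/

namespace BddKernel

variable {𝒳 : Type*} [MeasurableSpace 𝒳]

/-! Write `h = f_λ`, `f̂` for the estimator and `e = f̂ - h`. Both functions solve a normal
equation: `λ h = E (y - h(x)) k(·, x)` (`smul_regularizedSol`), and `λ f̂ = (1/n) ∑ (f_i - f̂(x_i))
k(·, x_i)`. Subtracting gives `λ e + (1/n) ∑ e(x_i) k(·, x_i) = D`, where `D` is the empirical mean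
of the centred scores of `h`. Pairing with `e` and dropping `(1/n) ∑ e(x_i)² ≥ 0` yields the
deterministic bound `λ ‖e‖ ≤ ‖D‖` (`mul_norm_krrEstimator_sub_le`).

Since `h` is not random, the summands of `D` are i.i.d. and centred. Expanding `‖D‖²`, the
off-diagonal terms vanish in expectation, so `E ‖D‖²` is `1/n` times the second moment of one score.
With `|g(x)| ≤ B ‖g‖` on `ℋ_k`, that moment is at most `B² E (y - h(x))² ≤ B² E y²`, uniformly in
`λ` (`integral_inner_centredScore_self_le`, `integral_residual_sq_le`). Hence the error in `ℋ_k` is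
of order `1/(λ² n)`, without a `λ⁻³` term, and the `L²(P)` bound costs another factor `B²`.

Expectations in `ℋ_k` are used only weakly, tested against elements of `ℋ_k`, so only scalar
functions are integrated. -/

/-- Evaluating `k(·, x)` at `x` gives `‖k(·, x)‖² ≤ B ‖k(·, x)‖`; one factor cancels. -/
lemma norm_kfun_le (k : BddKernel 𝒳) {B : ℝ} (hB0 : 0 ≤ B)
    (hB : ∀ (g : k.Hk) (x : 𝒳), |g x| ≤ B * ‖g‖) (x : 𝒳) : ‖k.kfun x‖ ≤ B := by
  have h := (le_abs_self _).trans (hB (k.kfun x) x)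
  rw [← inner_kfun, real_inner_self_eq_norm_sq] at h
  by_contra! hlt
  nlinarith

lemma norm_toL2_le (k : BddKernel 𝒳) (P : Measure 𝒳) [IsProbabilityMeasure P] {B : ℝ}
    (hB0 : 0 ≤ B) (hB : ∀ (g : k.Hk) (x : 𝒳), |g x| ≤ B * ‖g‖) (g : k.Hk) :
    ‖k.toL2 P g‖ ≤ B * ‖g‖ := by
  have h := Lp.norm_le_of_ae_bound (μ := P) (f := k.toL2 P g) (C := B * ‖g‖) (by positivity)
    (by filter_upwards [k.coeFn_toL2 P g] with x hx; rw [hx]; exact hB g x)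
  simpa [measureUnivNNReal] using h

lemma norm_toL2_sq (k : BddKernel 𝒳) (P : Measure 𝒳) [IsProbabilityMeasure P] (g : k.Hk) :
    ‖k.toL2 P g‖ ^ 2 = ∫ x, g x ^ 2 ∂P := by
  rw [← real_inner_self_eq_norm_sq, L2.inner_def]
  refine integral_congr_ae ?_
  filter_upwards [k.coeFn_toL2 P g] with x hx
  rw [hx, real_inner_self_eq_norm_sq, Real.norm_eq_abs, sq_abs]

lemma inner_toHk (k : BddKernel 𝒳) (P : Measure 𝒳) [IsProbabilityMeasure P] (w : Lp ℝ 2 P)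
    (g : k.Hk) : ⟪k.toHk P w, g⟫_ℝ = ∫ x, w x * g x ∂P := by
  rw [toHk, ContinuousLinearMap.adjoint_inner_left, L2.inner_def]
  refine integral_congr_ae ?_
  filter_upwards [k.coeFn_toL2 P g] with x hx
  rw [hx]
  simp [mul_comm]

end BddKernel

/-! ### The population problem: residuals and the normal equation. -/

section Regression

variable {𝒳 : Type*} [MeasurableSpace 𝒳]

lemma integrable_snd_mul {ρ : Measure (𝒳 × ℝ)} [IsProbabilityMeasure ρ]
    (hρ : MemLp (fun z : 𝒳 × ℝ => z.2) 2 ρ) {g : 𝒳 → ℝ} (hg : Measurable g) {C : ℝ}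
    (hC : ∀ x, |g x| ≤ C) : Integrable (fun z : 𝒳 × ℝ => z.2 * g z.1) ρ :=
  (hρ.integrable one_le_two).mul_bdd (hg.comp measurable_fst).aestronglyMeasurable
    (.of_forall fun z => hC z.1)

lemma integral_snd_mul {ρ : Measure (𝒳 × ℝ)} [IsProbabilityMeasure ρ]
    (hρ : MemLp (fun z : 𝒳 × ℝ => z.2) 2 ρ) {g : 𝒳 → ℝ} (hg : Measurable g) {C : ℝ}
    (hC : ∀ x, |g x| ≤ C) :
    ∫ z, z.2 * g z.1 ∂ρ = ∫ x, regressionFun ρ x * g x ∂ρ.fst := by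
  rw [← Measure.integral_condKernel (integrable_snd_mul hρ hg hC)]
  simp only [integral_mul_const, regressionFun]

/-- The representative in `ℋ_k` of the functional `g ↦ ∫ (f₀ - h) g dP`. -/
noncomputable def residualRep (k : BddKernel 𝒳) (ρ : Measure (𝒳 × ℝ)) [IsProbabilityMeasure ρ]
    (hρ : MemLp (fun z : 𝒳 × ℝ => z.2) 2 ρ) (h : k.Hk) : k.Hk :=
  k.toHk ρ.fst ((memLp_regressionFun ρ hρ).toLp (regressionFun ρ) - k.toL2 ρ.fst h)

lemma integrable_residual_mul (k : BddKernel 𝒳) {ρ : Measure (𝒳 × ℝ)} [IsProbabilityMeasure ρ]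
    (hρ : MemLp (fun z : 𝒳 × ℝ => z.2) 2 ρ) (h g : k.Hk) :
    Integrable (fun z : 𝒳 × ℝ => (z.2 - h z.1) * g z.1) ρ := by
  obtain ⟨B, -, hB⟩ := k.exists_bound
  have h1 := integrable_snd_mul hρ (k.measurable_coe g) (fun x => hB g x)
  have h2 : Integrable (fun z : 𝒳 × ℝ => h z.1 * g z.1) ρ :=
    ((k.memLp_coe ρ.fst h).integrable_mul (k.memLp_coe ρ.fst g)).comp_measurable measurable_fst
  exact (h1.sub h2).congr (.of_forall fun z => by simp only [Pi.sub_apply]; ring)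

/-- Identifies `residualRep` as the weak expectation of `(y - h(x)) k(·, x)`: conditioning on `x`
replaces `y` by `f₀(x)`. -/
lemma integral_residual_mul (k : BddKernel 𝒳) {ρ : Measure (𝒳 × ℝ)} [IsProbabilityMeasure ρ]
    (hρ : MemLp (fun z : 𝒳 × ℝ => z.2) 2 ρ) (h g : k.Hk) :
    ∫ z, (z.2 - h z.1) * g z.1 ∂ρ = ⟪residualRep k ρ hρ h, g⟫_ℝ := by
  obtain ⟨B, -, hB⟩ := k.exists_bound
  have h1 := integrable_snd_mul hρ (k.measurable_coe g) (fun x => hB g x)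
  have h2' := (k.memLp_coe ρ.fst h).integrable_mul (k.memLp_coe ρ.fst g)
  have h2 : Integrable (fun z : 𝒳 × ℝ => h z.1 * g z.1) ρ := h2'.comp_measurable measurable_fst
  have h3 : ∫ z : 𝒳 × ℝ, h z.1 * g z.1 ∂ρ = ∫ x, h x * g x ∂ρ.fst :=
    (integral_map measurable_fst.aemeasurable h2'.aestronglyMeasurable).symm
  simp only [sub_mul]
  rw [integral_sub h1 h2, integral_snd_mul hρ (k.measurable_coe g) (fun x => hB g x), h3,
    residualRep, map_sub, inner_sub_left, k.inner_toHk, k.inner_toHk]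
  congr 1 <;> refine integral_congr_ae ?_
  · filter_upwards [(memLp_regressionFun ρ hρ).coeFn_toLp] with x hx
    rw [hx]
  · filter_upwards [k.coeFn_toL2 ρ.fst h] with x hx
    rw [hx]

/-- The normal equation of the regularized solution. -/
lemma smul_regularizedSol (k : BddKernel 𝒳) (ρ : Measure (𝒳 × ℝ)) [IsProbabilityMeasure ρ]
    (hρ : MemLp (fun z : 𝒳 × ℝ => z.2) 2 ρ) {lam : ℝ} (hlam : 0 < lam) :
    lam • regularizedSol k ρ hρ lam = residualRep k ρ hρ (regularizedSol k ρ hρ lam) := by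
  set F := (memLp_regressionFun ρ hρ).toLp (regressionFun ρ) with hF
  have h : k.shiftedOp ρ.fst lam (k.resolvent ρ.fst lam F) = F := by
    rw [BddKernel.resolvent]
    exact DFunLike.congr_fun (Ring.mul_inverse_cancel _ (k.isUnit_shiftedOp ρ.fst hlam)) F
  rw [residualRep, ← hF]
  rw [regularizedSol, ← k.integralOp_apply, ← map_smul]
  -- Both sides are images under `toHk`; what remains is `λ w = f₀ - K w`, the defining equation of
  -- `w_λ`.
  congr 1
  rw [eq_sub_iff_add_eq, ← hF]
  exact h

lemma memLp_residual (k : BddKernel 𝒳) {ρ : Measure (𝒳 × ℝ)} [IsProbabilityMeasure ρ]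
    (hρ : MemLp (fun z : 𝒳 × ℝ => z.2) 2 ρ) (h : k.Hk) :
    MemLp (fun z : 𝒳 × ℝ => z.2 - h z.1) 2 ρ :=
  hρ.sub ((k.memLp_coe ρ.fst h).comp_measurePreserving (measurable_fst.measurePreserving ρ))

/-- With `r = y - h(x)`, one has `y² = r² + 2 r h + h²`, and the normal equation paired with `h`
gives `E r h = λ ‖h‖² ≥ 0`. -/
lemma integral_residual_sq_le (k : BddKernel 𝒳) {ρ : Measure (𝒳 × ℝ)} [IsProbabilityMeasure ρ]
    (hρ : MemLp (fun z : 𝒳 × ℝ => z.2) 2 ρ) {lam : ℝ} (hlam : 0 < lam) :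
    ∫ z, (z.2 - regularizedSol k ρ hρ lam z.1) ^ 2 ∂ρ ≤ ∫ z, z.2 ^ 2 ∂ρ := by
  set h := regularizedSol k ρ hρ lam
  have hrh := integral_residual_mul k hρ h h
  rw [← smul_regularizedSol k ρ hρ hlam, real_inner_smul_left, real_inner_self_eq_norm_sq] at hrh
  have hr2 := (memLp_residual k hρ h).integrable_sq
  have hrhi := integrable_residual_mul k hρ h h
  have hpos : 0 ≤ ∫ z, (z.2 - h z.1) * h z.1 ∂ρ := by rw [hrh]; positivity
  have key : ∫ z, ((z.2 - h z.1) ^ 2 + 2 * ((z.2 - h z.1) * h z.1)) ∂ρ ≤ ∫ z, z.2 ^ 2 ∂ρ :=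
    integral_mono (hr2.add (hrhi.const_mul 2)) hρ.integrable_sq
      fun z => by simp only; nlinarith [sq_nonneg (h z.1)]
  rw [integral_add hr2 (hrhi.const_mul 2), integral_const_mul] at key
  linarith

/-! ### First and second moments of the centred score. -/

/-- The centred summand `(y - h(x)) k(·, x) - E (y - h(x)) k(·, x)`. -/
noncomputable def centredScore (k : BddKernel 𝒳) (ρ : Measure (𝒳 × ℝ)) [IsProbabilityMeasure ρ]
    (hρ : MemLp (fun z : 𝒳 × ℝ => z.2) 2 ρ) (h : k.Hk) (z : 𝒳 × ℝ) : k.Hk :=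
  (z.2 - h z.1) • k.kfun z.1 - residualRep k ρ hρ h

lemma inner_centredScore (k : BddKernel 𝒳) (ρ : Measure (𝒳 × ℝ)) [IsProbabilityMeasure ρ]
    (hρ : MemLp (fun z : 𝒳 × ℝ => z.2) 2 ρ) (h : k.Hk) (z : 𝒳 × ℝ) (g : k.Hk) :
    ⟪centredScore k ρ hρ h z, g⟫_ℝ = (z.2 - h z.1) * g z.1 - ⟪residualRep k ρ hρ h, g⟫_ℝ := by
  rw [centredScore, inner_sub_left, real_inner_smul_left, k.inner_kfun]

lemma integral_inner_centredScore (k : BddKernel 𝒳) (ρ : Measure (𝒳 × ℝ))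
    [IsProbabilityMeasure ρ] (hρ : MemLp (fun z : 𝒳 × ℝ => z.2) 2 ρ) (h g : k.Hk) :
    ∫ z, ⟪centredScore k ρ hρ h z, g⟫_ℝ ∂ρ = 0 := by
  simp only [inner_centredScore]
  rw [integral_sub (integrable_residual_mul k hρ h g) (integrable_const _),
    integral_residual_mul k hρ h g]
  simp

/-- The scalar expansion lets integrability be checked without measurability of `x ↦ k(·, x)` as a
map into `ℋ_k`. -/
lemma inner_centredScore_centredScore (k : BddKernel 𝒳) (ρ : Measure (𝒳 × ℝ))
    [IsProbabilityMeasure ρ] (hρ : MemLp (fun z : 𝒳 × ℝ => z.2) 2 ρ) (h : k.Hk)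
    (z z' : 𝒳 × ℝ) :
    ⟪centredScore k ρ hρ h z, centredScore k ρ hρ h z'⟫_ℝ =
      (z.2 - h z.1) * (z'.2 - h z'.1) * k z.1 z'.1
        - (z.2 - h z.1) * residualRep k ρ hρ h z.1 - (z'.2 - h z'.1) * residualRep k ρ hρ h z'.1
        + ‖residualRep k ρ hρ h‖ ^ 2 := by
  simp only [centredScore, inner_sub_left, inner_sub_right, real_inner_smul_left,
    real_inner_smul_right, k.inner_kfun_kfun, k.inner_kfun, real_inner_self_eq_norm_sq,
    real_inner_comm (k.kfun z'.1) (residualRep k ρ hρ h)]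
  ring

lemma integrable_inner_centredScore_prod (k : BddKernel 𝒳) (ρ : Measure (𝒳 × ℝ))
    [IsProbabilityMeasure ρ] (hρ : MemLp (fun z : 𝒳 × ℝ => z.2) 2 ρ) (h : k.Hk) :
    Integrable (fun p : (𝒳 × ℝ) × (𝒳 × ℝ) =>
      ⟪centredScore k ρ hρ h p.1, centredScore k ρ hρ h p.2⟫_ℝ) (ρ.prod ρ) := by
  simp only [inner_centredScore_centredScore]
  obtain ⟨B, hB⟩ := k.bounded
  have hr := (memLp_residual k hρ h).integrable one_le_two
  have hm := integrable_residual_mul k hρ h (residualRep k ρ hρ h)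
  refine Integrable.add (Integrable.sub (Integrable.sub ?_ ?_) ?_) (integrable_const _)
  · exact (hr.mul_prod hr).mul_bdd (k.measurable.comp
      (by fun_prop : Measurable fun p : (𝒳 × ℝ) × (𝒳 × ℝ) =>
        (p.1.1, p.2.1))).aestronglyMeasurable (.of_forall fun p => hB _ _)
  · exact hm.comp_fst ρ
  · exact hm.comp_snd ρ

/-- By Fubini: with the second point fixed, its score is a fixed test element against which the
first score has mean zero. -/
lemma integral_inner_centredScore_prod (k : BddKernel 𝒳) (ρ : Measure (𝒳 × ℝ))
    [IsProbabilityMeasure ρ] (hρ : MemLp (fun z : 𝒳 × ℝ => z.2) 2 ρ) (h : k.Hk) :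
    ∫ p : (𝒳 × ℝ) × (𝒳 × ℝ),
      ⟪centredScore k ρ hρ h p.1, centredScore k ρ hρ h p.2⟫_ℝ ∂(ρ.prod ρ) = 0 := by
  rw [integral_prod_symm _ (integrable_inner_centredScore_prod k ρ hρ h)]
  simp only [integral_inner_centredScore, integral_zero]

lemma inner_centredScore_self (k : BddKernel 𝒳) (ρ : Measure (𝒳 × ℝ))
    [IsProbabilityMeasure ρ] (hρ : MemLp (fun z : 𝒳 × ℝ => z.2) 2 ρ) (h : k.Hk) (z : 𝒳 × ℝ) :
    ⟪centredScore k ρ hρ h z, centredScore k ρ hρ h z⟫_ℝ =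
      (z.2 - h z.1) ^ 2 * k z.1 z.1 - 2 * ((z.2 - h z.1) * residualRep k ρ hρ h z.1)
        + ‖residualRep k ρ hρ h‖ ^ 2 := by
  rw [inner_centredScore_centredScore]; ring

lemma integrable_residual_sq_mul_diag (k : BddKernel 𝒳) {ρ : Measure (𝒳 × ℝ)}
    [IsProbabilityMeasure ρ] (hρ : MemLp (fun z : 𝒳 × ℝ => z.2) 2 ρ) (h : k.Hk) :
    Integrable (fun z : 𝒳 × ℝ => (z.2 - h z.1) ^ 2 * k z.1 z.1) ρ := by
  obtain ⟨B, hB⟩ := k.bounded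
  exact (memLp_residual k hρ h).integrable_sq.mul_bdd (k.measurable.comp
    (by fun_prop : Measurable fun p : 𝒳 × ℝ => (p.1, p.1))).aestronglyMeasurable
    (.of_forall fun p => hB _ _)

lemma integrable_inner_centredScore_self (k : BddKernel 𝒳) (ρ : Measure (𝒳 × ℝ))
    [IsProbabilityMeasure ρ] (hρ : MemLp (fun z : 𝒳 × ℝ => z.2) 2 ρ) (h : k.Hk) :
    Integrable (fun z => ⟪centredScore k ρ hρ h z, centredScore k ρ hρ h z⟫_ℝ) ρ := by
  simp only [inner_centredScore_self]
  exact ((integrable_residual_sq_mul_diag k hρ h).sub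
    ((integrable_residual_mul k hρ h _).const_mul 2)).add (integrable_const _)

/-- A variance is at most the second moment: the terms in `m = residualRep` add up to `-2 ‖m‖² +
‖m‖² ≤ 0`. -/
lemma integral_inner_centredScore_self_le (k : BddKernel 𝒳) {ρ : Measure (𝒳 × ℝ)}
    [IsProbabilityMeasure ρ] (hρ : MemLp (fun z : 𝒳 × ℝ => z.2) 2 ρ) (h : k.Hk) {B : ℝ}
    (hB : ∀ x, k x x ≤ B) :
    ∫ z, ⟪centredScore k ρ hρ h z, centredScore k ρ hρ h z⟫_ℝ ∂ρ
      ≤ B * ∫ z, (z.2 - h z.1) ^ 2 ∂ρ := by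
  have h1 := integrable_residual_sq_mul_diag k hρ h
  have h2 := (integrable_residual_mul k hρ h (residualRep k ρ hρ h)).const_mul 2
  simp only [inner_centredScore_self]
  have h3 : ∫ z : 𝒳 × ℝ, (z.2 - h z.1) ^ 2 * k z.1 z.1 ∂ρ ≤ B * ∫ z, (z.2 - h z.1) ^ 2 ∂ρ := by
    rw [← integral_const_mul]
    refine integral_mono h1 ((memLp_residual k hρ h).integrable_sq.const_mul B) fun z => ?_
    simp only
    rw [mul_comm]
    gcongr
    exact hB _
  rw [integral_add (f := fun z : 𝒳 × ℝ => (z.2 - h z.1) ^ 2 * k z.1 z.1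
      - 2 * ((z.2 - h z.1) * residualRep k ρ hρ h z.1)) (h1.sub h2) (integrable_const _),
    integral_sub h1 h2, integral_const_mul,
    integral_residual_mul k hρ, real_inner_self_eq_norm_sq]
  simp
  nlinarith [sq_nonneg ‖residualRep k ρ hρ h‖]

end Regression

/-! ### The estimator: deterministic stability and measurability. -/

section Estimator

variable {𝒳 : Type*} [MeasurableSpace 𝒳]

lemma krrEstimator_apply (k : BddKernel 𝒳) (lam : ℝ) {n : ℕ} (x : Fin n → 𝒳) (f : Fin n → ℝ)
    (y : 𝒳) : krrEstimator k lam x f y = 1 / (n : ℝ) * ∑ j, k y (x j) * krrWeights k lam x f j := by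
  rw [← k.inner_kfun, krrEstimator, real_inner_smul_right, inner_sum]
  simp only [real_inner_smul_right, k.inner_kfun_kfun, mul_comm]

/-- Stability of the regularized normal equations: the empirical covariance is nonnegative, so it
can only help, and `λ` alone controls the inverse. -/
lemma mul_norm_krrEstimator_sub_le (k : BddKernel 𝒳) (ρ : Measure (𝒳 × ℝ))
    [IsProbabilityMeasure ρ] (hρ : MemLp (fun z : 𝒳 × ℝ => z.2) 2 ρ) {lam : ℝ} (hlam : 0 < lam)
    {n : ℕ} (hn : 1 ≤ n) (x : Fin n → 𝒳) (f : Fin n → ℝ) :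
    lam * ‖krrEstimator k lam x f - regularizedSol k ρ hρ lam‖ ≤
      ‖(1 / (n : ℝ)) • ∑ i, centredScore k ρ hρ (regularizedSol k ρ hρ lam) (x i, f i)‖ := by
  set h := regularizedSol k ρ hρ lam with hh
  set e := krrEstimator k lam x f - h with he
  set D := (1 / (n : ℝ)) • ∑ i, centredScore k ρ hρ h (x i, f i) with hD
  have hn0 : (n : ℝ) ≠ 0 := by positivity
  have hex (i) : e (x i) = krrEstimator k lam x f (x i) - h (x i) := by
    simp [he]
  -- The weights are the sample residuals divided by `λ`; this is the empirical normal equation.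
  have hw (i) : lam * krrWeights k lam x f i = f i - krrEstimator k lam x f (x i) := by
    rw [krrEstimator_apply, ← krrWeights_spec k hlam x f i]; ring
  have h1 : ⟪lam • krrEstimator k lam x f, e⟫_ℝ
      = 1 / (n : ℝ) * ∑ i, (f i - krrEstimator k lam x f (x i)) * e (x i) := by
    rw [krrEstimator, real_inner_smul_left, real_inner_smul_left, sum_inner, mul_left_comm,
      Finset.mul_sum]
    refine congrArg _ (Finset.sum_congr rfl fun i _ => ?_)
    rw [real_inner_smul_left, k.inner_kfun, ← mul_assoc, hw]
    rfl
  have h2 : ⟪D, e⟫_ℝ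
      = 1 / (n : ℝ) * ∑ i, (f i - h (x i)) * e (x i) - ⟪residualRep k ρ hρ h, e⟫_ℝ := by
    rw [hD, real_inner_smul_left, sum_inner]
    simp only [inner_centredScore, Finset.sum_sub_distrib, Finset.sum_const, Finset.card_univ,
      Fintype.card_fin, nsmul_eq_mul]
    field_simp
  have h3 : lam * ‖e‖ ^ 2 ≤ ⟪D, e⟫_ℝ := by
    rw [← real_inner_self_eq_norm_sq, ← real_inner_smul_left]
    nth_rw 1 [he]
    rw [smul_sub, inner_sub_left, h1, h2, hh, smul_regularizedSol k ρ hρ hlam, ← hh]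
    gcongr 1 / (n : ℝ) * ∑ i, ?_ - _ with i
    rw [show krrEstimator k lam x f (x i) = e (x i) + h (x i) by rw [hex]; ring]
    -- The two sides differ by `e(x_i)²`, the term being discarded.
    nlinarith [sq_nonneg (e (x i))]
  have h4 := real_inner_le_norm D e
  by_contra! hlt
  -- Strict positivity allows one factor `‖e‖` to be cancelled from `λ ‖e‖² ≤ ‖D‖ ‖e‖`.
  have h5 : 0 < ‖e‖ := by
    rcases (norm_nonneg e).eq_or_lt with h0 | h0
    · rw [← h0, mul_zero] at hlt
      exact absurd hlt (norm_nonneg D).not_gt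
    · exact h0
  nlinarith

lemma norm_smul_sum_sq {E ι : Type*} [NormedAddCommGroup E] [InnerProductSpace ℝ E] [Fintype ι]
    (c : ℝ) (v : ι → E) : ‖c • ∑ i, v i‖ ^ 2 = c ^ 2 * ∑ i, ∑ j, ⟪v i, v j⟫_ℝ := by
  rw [norm_smul, mul_pow, Real.norm_eq_abs, sq_abs, ← real_inner_self_eq_norm_sq, sum_inner]
  simp only [inner_sum]

/-- By Cramer's rule the inverse is `det⁻¹` times the adjugate, whose entries are polynomials in the
matrix entries. Since `0⁻¹ = 0` in `ℝ`, this also covers singular matrices, so no sign of `lam` is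
needed. -/
lemma measurable_krrWeights (k : BddKernel 𝒳) (lam : ℝ) (n : ℕ) (i : Fin n) :
    Measurable fun z : Fin n → 𝒳 × ℝ => krrWeights k lam (fun i => (z i).1) (fun i => (z i).2) i := by
  set M : (Fin n → 𝒳 × ℝ) → Matrix (Fin n) (Fin n) ℝ := fun z =>
    lam • (1 : Matrix (Fin n) (Fin n) ℝ) +
      (1 / (n : ℝ)) • Matrix.of fun i j => k (z i).1 (z j).1 with hM
  have hMm (i j) : Measurable fun z => M z i j := by
    simp only [hM, Matrix.add_apply, Matrix.smul_apply, Matrix.of_apply]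
    have hk : Measurable fun z : Fin n → 𝒳 × ℝ => k (z i).1 (z j).1 :=
      k.measurable.comp (by fun_prop : Measurable fun z : Fin n → 𝒳 × ℝ => ((z i).1, (z j).1))
    fun_prop
  have hdet (A : (Fin n → 𝒳 × ℝ) → Matrix (Fin n) (Fin n) ℝ)
      (hA : ∀ i j, Measurable fun z => A z i j) : Measurable fun z => (A z).det := by
    simp only [Matrix.det_apply]
    exact Finset.measurable_fun_sum _ fun σ _ =>
      (Finset.measurable_fun_prod _ fun i _ => hA _ _).const_smul _
  have hadj (i j) : Measurable fun z => (M z).adjugate i j := by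
    simp only [Matrix.adjugate_apply]
    refine hdet _ fun a b => ?_
    by_cases hab : a = j
    · subst hab; simp
    · simpa [Matrix.updateRow_ne hab] using hMm a b
  simp only [krrWeights, Matrix.mulVec, dotProduct]
  refine Finset.measurable_fun_sum _ fun j _ => Measurable.mul ?_ (by fun_prop)
  change Measurable fun z => (M z)⁻¹ i j
  simp only [Matrix.inv_def, Ring.inverse_eq_inv', Matrix.smul_apply, smul_eq_mul]
  exact (hdet M hMm).inv.mul (hadj i j)

lemma measurable_krrEstimator_apply (k : BddKernel 𝒳) (lam : ℝ) (n : ℕ) :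
    Measurable fun p : (Fin n → 𝒳 × ℝ) × 𝒳 =>
      krrEstimator k lam (fun i => (p.1 i).1) (fun i => (p.1 i).2) p.2 := by
  simp only [krrEstimator_apply]
  refine (Finset.measurable_fun_sum _ fun j _ => Measurable.mul ?_ ?_).const_mul _
  · exact k.measurable.comp
      (by fun_prop : Measurable fun p : (Fin n → 𝒳 × ℝ) × 𝒳 => (p.2, (p.1 j).1))
  · exact (measurable_krrWeights k lam n j).comp measurable_fst

lemma measurable_norm_krrEstimator_sub_sq (k : BddKernel 𝒳) (lam : ℝ) (n : ℕ) (h : k.Hk) :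
    Measurable fun z : Fin n → 𝒳 × ℝ =>
      ‖krrEstimator k lam (fun i => (z i).1) (fun i => (z i).2) - h‖ ^ 2 := by
  have hw := measurable_krrWeights k lam n
  have hk (i j : Fin n) : Measurable fun z : Fin n → 𝒳 × ℝ => k (z i).1 (z j).1 :=
    k.measurable.comp (by fun_prop : Measurable fun z : Fin n → 𝒳 × ℝ => ((z i).1, (z j).1))
  have hh := k.measurable_coe h
  simp only [norm_sub_sq_real]
  -- The squared norm becomes a polynomial in the weights, the Gram entries and the values `h(x_i)`,
  -- plus a constant.
  simp only [krrEstimator, norm_smul_sum_sq, real_inner_smul_left, real_inner_smul_right,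
    sum_inner, k.inner_kfun_kfun, k.inner_kfun]
  fun_prop

/-- The squared norm is an integral over `P` of a function jointly measurable in the sample and the
evaluation point. -/
lemma measurable_norm_toL2_krrEstimator_sub_sq (k : BddKernel 𝒳) (P : Measure 𝒳)
    [IsProbabilityMeasure P] (lam : ℝ) (n : ℕ) (h : k.Hk) :
    Measurable fun z : Fin n → 𝒳 × ℝ =>
      ‖k.toL2 P (krrEstimator k lam (fun i => (z i).1) (fun i => (z i).2) - h)‖ ^ 2 := by
  simp only [k.norm_toL2_sq, RKHS.coe_sub, Pi.sub_apply]
  have hm := (((measurable_krrEstimator_apply k lam n).sub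
    ((k.measurable_coe h).comp measurable_snd)).pow_const 2).stronglyMeasurable
  exact hm.integral_prod_right'.measurable

end Estimator

/-! ### Second moments of i.i.d. sums. -/

section Sampling

variable {Ω E : Type*} [MeasurableSpace Ω] [MeasurableSpace E]

/-- The expectation of a double sum over an i.i.d. sample, for a function `G` of
pairs whose integral over independent pairs vanishes. -/
lemma integrable_integral_sum_sum_of_iid {μ : Measure Ω} [IsProbabilityMeasure μ]
    {ρ : Measure E} [IsProbabilityMeasure ρ] {n : ℕ} {Z : Fin n → Ω → E}
    (hZ : ∀ i, HasLaw (Z i) ρ μ) (hind : iIndepFun Z μ) {G : E → E → ℝ}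
    (hoff : Integrable (fun p : E × E => G p.1 p.2) (ρ.prod ρ))
    (hoff0 : ∫ p : E × E, G p.1 p.2 ∂(ρ.prod ρ) = 0)
    (hdiag : Integrable (fun z => G z z) ρ) :
    Integrable (fun ω => ∑ i, ∑ j, G (Z i ω) (Z j ω)) μ ∧
      ∫ ω, ∑ i, ∑ j, G (Z i ω) (Z j ω) ∂μ = n * ∫ z, G z z ∂ρ := by
  have hd (i) : Integrable (fun ω => G (Z i ω) (Z i ω)) μ ∧
      ∫ ω, G (Z i ω) (Z i ω) ∂μ = ∫ z, G z z ∂ρ := by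
    have h := hdiag
    rw [← (hZ i).map_eq] at h
    exact ⟨h.comp_aemeasurable (hZ i).aemeasurable,
      (hZ i).integral_comp hdiag.aestronglyMeasurable⟩
  have hpair {i j} (hij : i ≠ j) : HasLaw (fun ω => (Z i ω, Z j ω)) (ρ.prod ρ) μ := by
    refine ⟨(hZ i).aemeasurable.prodMk (hZ j).aemeasurable, ?_⟩
    rw [(indepFun_iff_map_prod_eq_prod_map_map (hZ i).aemeasurable (hZ j).aemeasurable).mp
      (hind.indepFun hij), (hZ i).map_eq, (hZ j).map_eq]
  have ho {i j} (hij : i ≠ j) : Integrable (fun ω => G (Z i ω) (Z j ω)) μ ∧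
      ∫ ω, G (Z i ω) (Z j ω) ∂μ = 0 := by
    have h := hoff
    rw [← (hpair hij).map_eq] at h
    exact ⟨h.comp_aemeasurable (hpair hij).aemeasurable,
      ((hpair hij).integral_comp hoff.aestronglyMeasurable).trans hoff0⟩
  have hi (i j) : Integrable (fun ω => G (Z i ω) (Z j ω)) μ := by
    by_cases hij : i = j
    · subst hij; exact (hd i).1
    · exact (ho hij).1
  refine ⟨integrable_finsetSum _ fun i _ => integrable_finsetSum _ fun j _ => hi i j, ?_⟩
  rw [integral_finsetSum _ fun i _ => integrable_finsetSum _ fun j _ => hi i j]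
  -- In each row only the diagonal entry survives.
  have hrow (i) : ∫ ω, ∑ j, G (Z i ω) (Z j ω) ∂μ = ∫ z, G z z ∂ρ := by
    rw [integral_finsetSum _ fun j _ => hi i j, Finset.sum_eq_single i, (hd i).2]
    · exact fun j _ hj => (ho (Ne.symm hj)).2
    · simp
  simp [hrow]

end Sampling

/-! ### Mean square errors. -/

section MeanSquareError

variable {𝒳 Ω : Type*} [MeasurableSpace 𝒳] [MeasurableSpace Ω]

/-- The mean square error of kernel ridge regression in `ℋ_k`. -/
lemma integral_norm_krrEstimator_sub_sq_le (k : BddKernel 𝒳) (ρ : Measure (𝒳 × ℝ))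
    [IsProbabilityMeasure ρ] (hρ : MemLp (fun z : 𝒳 × ℝ => z.2) 2 ρ) {B : ℝ} (hB0 : 0 ≤ B)
    (hB : ∀ x, k x x ≤ B) {lam : ℝ} (hlam : 0 < lam) {n : ℕ} (hn : 1 ≤ n)
    {μ : Measure Ω} [IsProbabilityMeasure μ] {X : Fin n → Ω → 𝒳} {f : Fin n → Ω → ℝ}
    (hlaw : ∀ i, HasLaw (fun ω => (X i ω, f i ω)) ρ μ)
    (hind : iIndepFun (fun i ω => (X i ω, f i ω)) μ) :
    Integrable (fun ω => ‖krrEstimator k lam (fun i => X i ω) (fun i => f i ω)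
        - regularizedSol k ρ hρ lam‖ ^ 2) μ ∧
      ∫ ω, ‖krrEstimator k lam (fun i => X i ω) (fun i => f i ω)
        - regularizedSol k ρ hρ lam‖ ^ 2 ∂μ ≤ B * (∫ z, z.2 ^ 2 ∂ρ) / (lam ^ 2 * n) := by
  set h := regularizedSol k ρ hρ lam with hh
  have hn0 : (0 : ℝ) < n := by positivity
  have hZ : AEMeasurable (fun ω i => (X i ω, f i ω)) μ :=
    aemeasurable_pi_lambda _ fun i => (hlaw i).aemeasurable
  obtain ⟨hI, hE⟩ := integrable_integral_sum_sum_of_iid hlaw hind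
    (G := fun z z' => ⟪centredScore k ρ hρ h z, centredScore k ρ hρ h z'⟫_ℝ)
    (integrable_inner_centredScore_prod k ρ hρ h) (integral_inner_centredScore_prod k ρ hρ h)
    (integrable_inner_centredScore_self k ρ hρ h)
  have hV := (integral_inner_centredScore_self_le k hρ h hB).trans
    (mul_le_mul_of_nonneg_left (integral_residual_sq_le k hρ hlam) hB0)
  have hle (ω : Ω) : ‖krrEstimator k lam (fun i => X i ω) (fun i => f i ω) - h‖ ^ 2 ≤
      1 / (lam ^ 2 * n ^ 2) * ∑ i, ∑ j, ⟪centredScore k ρ hρ h (X i ω, f i ω),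
        centredScore k ρ hρ h (X j ω, f j ω)⟫_ℝ := by
    have h1 := mul_norm_krrEstimator_sub_le k ρ hρ hlam hn (fun i => X i ω) (fun i => f i ω)
    rw [← hh] at h1
    have h2 := pow_le_pow_left₀ (by positivity) h1 2
    rw [norm_smul_sum_sq, mul_pow, ← le_div_iff₀' (by positivity)] at h2
    refine h2.trans_eq ?_
    field_simp
  have hint := (hI.const_mul (1 / (lam ^ 2 * n ^ 2))).mono'
    ((measurable_norm_krrEstimator_sub_sq k lam n h).comp_aemeasurable hZ).aestronglyMeasurable
    (.of_forall fun ω => by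
      exact (Real.norm_of_nonneg (sq_nonneg _)).trans_le (hle ω))
  refine ⟨hint, (integral_mono hint (hI.const_mul _) hle).trans ?_⟩
  -- The `n` diagonal terms against the prefactor `1/n²` leave the rate `1/n`.
  rw [integral_const_mul, hE]
  calc _ ≤ 1 / (lam ^ 2 * n ^ 2) * (n * (B * ∫ z, z.2 ^ 2 ∂ρ)) := by gcongr
    _ = _ := by field_simp

/-- The mean square error of kernel ridge regression in `L²(P)`, bounded by the one in `ℋ_k`. -/
lemma integral_norm_toL2_krrEstimator_sub_sq_le (k : BddKernel 𝒳) (P : Measure 𝒳)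
    [IsProbabilityMeasure P] {B : ℝ} (hB0 : 0 ≤ B)
    (hB : ∀ (g : k.Hk) (x : 𝒳), |g x| ≤ B * ‖g‖) (lam : ℝ) {n : ℕ} (h : k.Hk)
    {μ : Measure Ω} {X : Fin n → Ω → 𝒳} {f : Fin n → Ω → ℝ}
    (hZ : AEMeasurable (fun ω i => (X i ω, f i ω)) μ)
    (hint : Integrable (fun ω =>
      ‖krrEstimator k lam (fun i => X i ω) (fun i => f i ω) - h‖ ^ 2) μ) :
    Integrable (fun ω => ‖k.toL2 P (krrEstimator k lam (fun i => X i ω) (fun i => f i ω)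
        - h)‖ ^ 2) μ ∧
      ∫ ω, ‖k.toL2 P (krrEstimator k lam (fun i => X i ω) (fun i => f i ω) - h)‖ ^ 2 ∂μ ≤
        B ^ 2 * ∫ ω, ‖krrEstimator k lam (fun i => X i ω) (fun i => f i ω) - h‖ ^ 2 ∂μ := by
  have hle (ω : Ω) : ‖k.toL2 P (krrEstimator k lam (fun i => X i ω) (fun i => f i ω) - h)‖ ^ 2 ≤
      B ^ 2 * ‖krrEstimator k lam (fun i => X i ω) (fun i => f i ω) - h‖ ^ 2 := by
    rw [← mul_pow]
    exact pow_le_pow_left₀ (norm_nonneg _) (k.norm_toL2_le P hB0 hB _) 2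
  have hintL := (hint.const_mul (B ^ 2)).mono'
    ((measurable_norm_toL2_krrEstimator_sub_sq k P lam n h).comp_aemeasurable
      hZ).aestronglyMeasurable
    (.of_forall fun ω => by
      exact (Real.norm_of_nonneg (sq_nonneg _)).trans_le (hle ω))
  refine ⟨hintL, ?_⟩
  rw [← integral_const_mul]
  exact integral_mono hintL (hint.const_mul _) hle

end MeanSquareError

theorem theorem6 {𝒳 : Type*} [MeasurableSpace 𝒳] (k : BddKernel 𝒳)
    (ρ : Measure (𝒳 × ℝ)) [IsProbabilityMeasure ρ]
    (hρ : MemLp (fun z : 𝒳 × ℝ => z.2) 2 ρ) :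
    ∃ C₁ C₂ : ℝ, 0 < C₁ ∧ 0 < C₂ ∧
      ∀ (lam : ℝ), 0 < lam → ∀ (n : ℕ), 1 ≤ n →
      ∀ (Ω : Type*) [MeasurableSpace Ω] (μ : Measure Ω) [IsProbabilityMeasure μ]
        (X : Fin n → Ω → 𝒳) (f : Fin n → Ω → ℝ),
        (∀ i, HasLaw (fun ω => (X i ω, f i ω)) ρ μ) →
        iIndepFun (fun i ω => (X i ω, f i ω)) μ →
        (Integrable (fun ω => ‖krrEstimator k lam (fun i => X i ω) (fun i => f i ω)
            - regularizedSol k ρ hρ lam‖ ^ 2) μ ∧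
          ∫ ω, ‖krrEstimator k lam (fun i => X i ω) (fun i => f i ω)
            - regularizedSol k ρ hρ lam‖ ^ 2 ∂μ
            ≤ 2 * C₁ / (lam ^ 2 * n) + C₂ / (lam ^ 3 * n)) ∧
        (Integrable (fun ω => ‖k.toL2 ρ.fst (krrEstimator k lam (fun i => X i ω) (fun i => f i ω)
            - regularizedSol k ρ hρ lam)‖ ^ 2) μ ∧
          ∫ ω, ‖k.toL2 ρ.fst (krrEstimator k lam (fun i => X i ω) (fun i => f i ω)
            - regularizedSol k ρ hρ lam)‖ ^ 2 ∂μ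
            ≤ 2 * C₁ / (lam ^ 2 * n) + C₂ / (lam ^ 3 * n)) := by
  obtain ⟨B, hB0, hB⟩ := k.exists_bound
  have hdiag (x : 𝒳) : k x x ≤ B ^ 2 := by
    rw [← k.inner_kfun_kfun, real_inner_self_eq_norm_sq]
    exact pow_le_pow_left₀ (norm_nonneg _) (k.norm_kfun_le hB0 hB x) 2
  set S := ∫ z, z.2 ^ 2 ∂ρ with hS
  have hS0 : 0 ≤ S := integral_nonneg fun z => sq_nonneg _
  -- `B² S` serves the `ℋ_k` bound and `B⁴ S` the `L²(P)` bound; the `1` keeps `C₁` positive when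
  -- `B` or `S` vanishes. The `λ⁻³` term is pure slack, so any positive `C₂` would do.
  refine ⟨B ^ 2 * S + B ^ 4 * S + 1, 1, by positivity, one_pos, ?_⟩
  intro lam hlam n hn Ω _ μ _ X f hlaw hind
  obtain ⟨h1, h2⟩ := integral_norm_krrEstimator_sub_sq_le k ρ hρ (sq_nonneg B) hdiag hlam hn
    hlaw hind
  obtain ⟨h3, h4⟩ := integral_norm_toL2_krrEstimator_sub_sq_le k ρ.fst hB0 hB lam
    (regularizedSol k ρ hρ lam) (aemeasurable_pi_lambda _ fun i => (hlaw i).aemeasurable) h1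
  have hbound {a : ℝ} (ha : a ≤ B ^ 2 * S + B ^ 4 * S) : a / (lam ^ 2 * n) ≤
      2 * (B ^ 2 * S + B ^ 4 * S + 1) / (lam ^ 2 * n) + 1 / (lam ^ 3 * n) := by
    have hpos : 0 ≤ B ^ 2 * S + B ^ 4 * S := by positivity
    refine le_add_of_le_of_nonneg ?_ (by positivity)
    gcongr
    linarith
  have hb2 : 0 ≤ B ^ 2 * S := by positivity
  have hb4 : 0 ≤ B ^ 4 * S := by positivity
  refine ⟨⟨h1, h2.trans (hbound (by linarith))⟩, h3, h4.trans ?_⟩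
  refine (mul_le_mul_of_nonneg_left h2 (sq_nonneg B)).trans ?_
  rw [← mul_div_assoc]
  exact hbound (by nlinarith)
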